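/- Let $A$ be a (complex, not necessarily unital) C*-algebra, and for $a,b\in A$ write $a\ll b$ if $a=ab$. A directed set is a nonempty set $\Lambda$ with a transitive (not necessarily reflexive) relation $\prec$ such that for all $\lambda,\mu\in\Lambda$ there is $\nu\in\Lambda$ with $\lambda\prec\nu$ and $\mu\prec\nu$. An approximate unit of $A$ is a net $(u_\lambda)_{\lambda\in\Lambda}$, indexed by a directed set $(\Lambda,\prec)$, of positive elements of $A$ of norm at most $1$, such that $\|a-au_\lambda\|\to 0$ along $(\Lambda,\prec)$ for every $a\in A$; its size is the cardinality of $\Lambda$. It is $\ll$-increasing if $u_\lambda\ll u_\mu$ whenever $\lambda\prec\mu$. **Theorem.** If $A$ is $\omega_1$-unital, that is, if $A$ has an approximate unit of size at most $\omega_1$ (the first uncountable cardinal), then $A$ is $\ll$-unital, that is, $A$ has a $\ll$-increasing approximate unit. -/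

import Mathlib

open scoped Cardinal

universe u v

/-- The relation `a ≪ b` on an algebra: `a = a * b`. -/
def IsWayBelow {A : Type*} [Mul A] (a b : A) : Prop :=
  a = a * b

/-- `(Λ, r)` is a directed set: nonempty, with `r` transitive, such that any two elements have a
common `r`-successor. The relation is not required to be reflexive. -/
structure IsDirectedSet {Λ : Type*} (r : Λ → Λ → Prop) : Prop where
  nonempty : Nonempty Λ
  trans : ∀ i j k : Λ, r i j → r j k → r i k
  directed : ∀ i j : Λ, ∃ k : Λ, r i k ∧ r j k

/-- The net `u`, indexed by the directed set `(Λ, r)`, is an approximate unit of the C*-algebra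
`A`: it lies in the positive part of the closed unit ball, and `‖a - a * u i‖` converges to `0`
along `(Λ, r)` for every `a`. -/
structure IsApproxUnitNet {A : Type*} [NonUnitalCStarAlgebra A] [PartialOrder A]
    [StarOrderedRing A] {Λ : Type*} (r : Λ → Λ → Prop) (u : Λ → A) : Prop where
  isDirectedSet : IsDirectedSet r
  nonneg : ∀ i : Λ, 0 ≤ u i
  norm_le_one : ∀ i : Λ, ‖u i‖ ≤ 1
  tendsto : ∀ a : A, ∀ ε : ℝ, 0 < ε → ∃ i₀ : Λ, ∀ i : Λ, r i₀ i → ‖a - a * u i‖ < ε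

/-- The net `u` is `≪`-increasing: `u i ≪ u j` whenever `r i j`. -/
def IsWayBelowIncreasing {A : Type*} [Mul A] {Λ : Type*} (r : Λ → Λ → Prop) (u : Λ → A) : Prop :=
  ∀ i j : Λ, r i j → IsWayBelow (u i) (u j)

/-- `A` is `κ`-unital: it has an approximate unit indexed by a directed set of cardinality at
most `κ`. -/
def IsCardinalUnital (κ : Cardinal.{v}) (A : Type u) [NonUnitalCStarAlgebra A]
    [PartialOrder A] [StarOrderedRing A] : Prop :=
  ∃ (Λ : Type v) (r : Λ → Λ → Prop) (u : Λ → A), #Λ ≤ κ ∧ IsApproxUnitNet r u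

/-- `A` is `≪`-unital: it has a `≪`-increasing approximate unit. -/
def IsWayBelowUnital (A : Type u) [NonUnitalCStarAlgebra A]
    [PartialOrder A] [StarOrderedRing A] : Prop :=
  ∃ (Λ : Type u) (r : Λ → Λ → Prop) (u : Λ → A), IsApproxUnitNet r u ∧ IsWayBelowIncreasing r u

/-!
The heart of the matter is a one-step extension: a countable `≪`-directed set `U` of positive
contractions and an element `a` admit a countable `≪`-directed set `V ⊇ U` of positive
contractions with `inf_{v ∈ V} ‖a - a * v‖ = 0` (`IsWayBelowDirected.exists_extension`). Given
this, well-order the index set of an approximate unit `u` of size at most `ℵ₁` so that all initial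
segments are countable, and apply the extension to the elements `u i` by transfinite recursion.
What has been built before a given stage is a countable union of a chain of countable directed
sets, hence again countable and directed; this is where `ℵ₁` enters. The union of all stages,
indexed by itself and ordered by `≪`, is the required approximate unit, because `v ≪ w` gives
`x - x * w = (x - x * v) * (1 - w)` and every `a` is a limit of products `a * u i`.

For the extension, replace `U` by a cofinal sequence `b 0 ≪ b 1 ≪ ⋯`. If `d` is far along the
canonical approximate unit, then `c = 1 - (1 - b k) * (1 - d) * (1 - b k)` is a positive
contraction in `A`, is a right unit for everything way below `b k`, and is nearly a right unit for
any finitely many given elements. Successive choices give `c 0, c 1, …` with `b k ≪ c k`,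
`a * c k` close to `a` and `c k * c (k + 1)` very close to `c k`; only the last relation fails
to be the required exact one. It is repaired by passing to a sequence `e` close to `c` with
`e n = f (e (n + 1)) * c n * f (e (n + 1))`, where `f` vanishes near `0` and `f 1 = 1`
(`exists_perturbed_seq`). If `g` is `1` on the support of `f` and `g 0 = 0`, then
`e n ≪ g (e (n + 1))`, hence `g (e n) ≪ g (e (n + 1))`. Both operations preserve `b n ≪ ·`;
the first one moves `c n` only a little, and the second one at most doubles `‖a - a * e n‖`.
-/

/-! ### Way-below relation and the positive unit ball -/

lemma IsWayBelow.trans {M : Type*} [Semigroup M] {a b c : M} (hab : IsWayBelow a b)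
    (hbc : IsWayBelow b c) : IsWayBelow a c := by
  unfold IsWayBelow at *
  calc a = a * b := hab
    _ = a * (b * c) := by rw [← hbc]
    _ = a * c := by rw [← mul_assoc, ← hab]

lemma isWayBelow_of_lt {M : Type*} [Semigroup M] {x : ℕ → M}
    (hx : ∀ n, IsWayBelow (x n) (x (n + 1))) {m n : ℕ} (hmn : m < n) :
    IsWayBelow (x m) (x n) := by
  induction n, (hmn : m + 1 ≤ n) using Nat.le_induction with
  | base => exact hx m
  | succ k hk ih => exact ih.trans (hx k)

/-- The positive part of the closed unit ball of `A`. -/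
def posUnitBall (A : Type*) [NonUnitalCStarAlgebra A] [PartialOrder A] : Set A :=
  {x | 0 ≤ x ∧ ‖x‖ ≤ 1}

section

variable {A : Type u} [NonUnitalCStarAlgebra A] [PartialOrder A] [StarOrderedRing A]

lemma isClosed_posUnitBall : IsClosed (posUnitBall A) :=
  (isClosed_le continuous_const continuous_id).inter
    (isClosed_le continuous_norm continuous_const)

lemma isSelfAdjoint_of_mem_posUnitBall {x : A} (hx : x ∈ posUnitBall A) : IsSelfAdjoint x :=
  .of_nonneg hx.1

lemma quasispectrum_subset_Icc {x : A} (hx : x ∈ posUnitBall A) :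
    quasispectrum ℝ x ⊆ Set.Icc 0 1 := fun t ht ↦
  ⟨quasispectrum_nonneg_of_nonneg x hx.1 t ht,
    (le_abs_self t).trans <|
      (NonUnitalIsometricContinuousFunctionalCalculus.norm_quasispectrum_le x ht
        (isSelfAdjoint_of_mem_posUnitBall hx)).trans hx.2⟩

lemma cfcₙ_mem_posUnitBall {x : A} {f : ℝ → ℝ} (hx : x ∈ posUnitBall A)
    (hf : ∀ t ∈ Set.Icc (0 : ℝ) 1, f t ∈ Set.Icc (0 : ℝ) 1) : cfcₙ f x ∈ posUnitBall A :=
  ⟨cfcₙ_nonneg fun t ht ↦ (hf t (quasispectrum_subset_Icc hx ht)).1,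
    norm_cfcₙ_le fun t ht ↦ by
      have := hf t (quasispectrum_subset_Icc hx ht)
      rw [Real.norm_of_nonneg this.1]; exact this.2⟩

/-- If `1 - f t = (1 - t) * (1 + h t)` with `|h| ≤ 1` on `[0, 1]`, then `f x` acts as a right unit
on `a` at least half as well as `x` does. -/
lemma norm_sub_mul_cfcₙ_le {x : A} (a : A) {f h : ℝ → ℝ} (hx : x ∈ posUnitBall A)
    (hh : Continuous h) (hh0 : h 0 = 0) (hh1 : ∀ t ∈ Set.Icc (0 : ℝ) 1, |h t| ≤ 1)
    (hf : ∀ t ∈ Set.Icc (0 : ℝ) 1, f t = t - h t + t * h t) :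
    ‖a - a * cfcₙ f x‖ ≤ 2 * ‖a - a * x‖ := by
  have hs := isSelfAdjoint_of_mem_posUnitBall hx
  have key : cfcₙ f x = x - cfcₙ h x + x * cfcₙ h x := by
    rw [cfcₙ_congr fun t ht ↦ hf t (quasispectrum_subset_Icc hx ht),
      cfcₙ_add (fun t ↦ t - h t) (fun t ↦ t * h t) x (by fun_prop) (by simp [hh0])
        (by fun_prop) (by simp),
      cfcₙ_sub (fun t ↦ t) h x, cfcₙ_mul (fun t ↦ t) h x, cfcₙ_id' ℝ x]
  have hn : ‖cfcₙ h x‖ ≤ 1 := norm_cfcₙ_le fun t ht ↦ hh1 t (quasispectrum_subset_Icc hx ht)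
  have : a - a * cfcₙ f x = (a - a * x) + (a - a * x) * cfcₙ h x := by
    rw [key]; noncomm_ring
  rw [this]
  calc _ ≤ ‖a - a * x‖ + ‖a - a * x‖ * ‖cfcₙ h x‖ :=
        (norm_add_le _ _).trans (by gcongr; exact norm_mul_le _ _)
    _ ≤ ‖a - a * x‖ + ‖a - a * x‖ * 1 := by gcongr
    _ = _ := by ring

/-- If `f t = t * (κ + k t)`, then a right unit for `x` is a right unit for `f x`. -/
lemma IsWayBelow.cfcₙ_left {x y : A} {f k : ℝ → ℝ} {κ : ℝ} (hx : x ∈ posUnitBall A)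
    (hk : Continuous k) (hk0 : k 0 = 0)
    (hf : ∀ t ∈ Set.Icc (0 : ℝ) 1, f t = κ * t + k t * t) (hxy : IsWayBelow x y) :
    IsWayBelow (cfcₙ f x) y := by
  have hs := isSelfAdjoint_of_mem_posUnitBall hx
  have key : cfcₙ f x = κ • x + cfcₙ k x * x := by
    rw [cfcₙ_congr fun t ht ↦ hf t (quasispectrum_subset_Icc hx ht),
      cfcₙ_add (fun t ↦ κ * t) (fun t ↦ k t * t) x (by fun_prop) (by simp)
        (by fun_prop) (by simp),
      cfcₙ_const_mul κ (fun t ↦ t) x, cfcₙ_mul k (fun t ↦ t) x, cfcₙ_id' ℝ x]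
  unfold IsWayBelow at *
  rw [key, add_mul, mul_assoc, ← hxy, smul_mul_assoc, ← hxy]

/-- The piecewise linear function that vanishes on `[0, 1/2]` and is `1` at `1`. -/
noncomputable def lowerCut (t : ℝ) : ℝ := max 0 (2 * t - 1)

/-- The piecewise linear function that vanishes at `0` and is `1` on the support of `lowerCut`. -/
noncomputable def upperCut (t : ℝ) : ℝ := min 1 (2 * t)

lemma continuous_lowerCut : Continuous lowerCut := by unfold lowerCut; fun_prop

lemma continuous_upperCut : Continuous upperCut := by unfold upperCut; fun_prop

lemma lowerCut_zero : lowerCut 0 = 0 := by norm_num [lowerCut]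

lemma upperCut_zero : upperCut 0 = 0 := by norm_num [upperCut]

lemma lowerCut_mul_upperCut (t : ℝ) : lowerCut t * upperCut t = lowerCut t := by
  unfold lowerCut upperCut
  rcases le_total (2 * t - 1) 0 with h | h
  · rw [max_eq_left h, zero_mul]
  · rw [min_eq_left (by linarith), mul_one]

lemma lowerCut_mem_Icc (t : ℝ) (ht : t ∈ Set.Icc (0 : ℝ) 1) :
    lowerCut t ∈ Set.Icc (0 : ℝ) 1 :=
  ⟨le_max_left _ _, max_le zero_le_one (by linarith [ht.2])⟩

lemma upperCut_mem_Icc (t : ℝ) (ht : t ∈ Set.Icc (0 : ℝ) 1) :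
    upperCut t ∈ Set.Icc (0 : ℝ) 1 :=
  ⟨le_min zero_le_one (by linarith [ht.1]), min_le_left _ _⟩

lemma max_half_pos (s : ℝ) : 0 < max s (1 / 2) := lt_max_of_lt_right (by norm_num)

lemma norm_sub_mul_lowerCut_le {x : A} (a : A) (hx : x ∈ posUnitBall A) :
    ‖a - a * cfcₙ lowerCut x‖ ≤ 2 * ‖a - a * x‖ := by
  refine norm_sub_mul_cfcₙ_le (h := fun t ↦ (max (1 - t) (1 / 2))⁻¹ - 1) a hx ?_ (by norm_num)
    ?_ ?_
  · exact (Continuous.inv₀ (by fun_prop) fun t ↦ (max_half_pos _).ne').sub continuous_const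
  · intro t ht
    have h2 := max_half_pos (1 - t)
    have h1 : max (1 - t) (1 / 2) ≤ 1 := max_le (by linarith [ht.1]) (by norm_num)
    rw [abs_le]
    constructor
    · linarith [inv_pos.2 h2]
    · have : (max (1 - t) (1 / 2))⁻¹ ≤ (1 / 2 : ℝ)⁻¹ :=
        inv_anti₀ (by norm_num) (le_max_right _ _)
      norm_num at this ⊢; linarith
  · intro t ht
    unfold lowerCut
    rcases le_total (1 - t) (1 / 2) with h | h
    · rw [max_eq_right h, max_eq_right (by linarith)]; ring
    · rw [max_eq_left h, max_eq_left (by linarith)]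
      have : (1 - t) ≠ 0 := by linarith
      field_simp; ring

lemma norm_sub_mul_upperCut_le {x : A} (a : A) (hx : x ∈ posUnitBall A) :
    ‖a - a * cfcₙ upperCut x‖ ≤ 2 * ‖a - a * x‖ := by
  refine norm_sub_mul_cfcₙ_le
    (h := fun t ↦ max 0 (1 - 2 * t) * (max (1 - t) (1 / 2))⁻¹ - 1) a hx ?_ (by norm_num) ?_ ?_
  · exact ((by fun_prop : Continuous fun t : ℝ ↦ max 0 (1 - 2 * t)).mul
      (Continuous.inv₀ (by fun_prop) fun t ↦ (max_half_pos _).ne')).sub continuous_const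
  · intro t ht
    have h2 := max_half_pos (1 - t)
    have h0 : 0 ≤ max 0 (1 - 2 * t) := le_max_left _ _
    have h3 : max 0 (1 - 2 * t) * (max (1 - t) (1 / 2))⁻¹ ≤ 1 := by
      rw [← div_eq_mul_inv, div_le_one h2]
      exact max_le h2.le ((by linarith [ht.1] : 1 - 2 * t ≤ 1 - t).trans (le_max_left _ _))
    have h4 : 0 ≤ max 0 (1 - 2 * t) * (max (1 - t) (1 / 2))⁻¹ := by positivity
    rw [abs_le]
    constructor <;> linarith
  · intro t ht
    unfold upperCut
    rcases le_total (1 - t) (1 / 2) with h | h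
    · rw [max_eq_right h, max_eq_left (by linarith), min_eq_left (by linarith)]; ring
    · rw [max_eq_left h, max_eq_right (by linarith), min_eq_right (by linarith)]
      have : (1 - t) ≠ 0 := by linarith
      field_simp; ring

lemma IsWayBelow.lowerCut_right {b x : A} (hx : x ∈ posUnitBall A) (h : IsWayBelow b x) :
    IsWayBelow b (cfcₙ lowerCut x) := by
  have := norm_sub_mul_lowerCut_le b hx
  rw [← h, sub_self, norm_zero, mul_zero] at this
  exact sub_eq_zero.1 (norm_le_zero_iff.1 this)

lemma IsWayBelow.upperCut_right {b x : A} (hx : x ∈ posUnitBall A) (h : IsWayBelow b x) :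
    IsWayBelow b (cfcₙ upperCut x) := by
  have := norm_sub_mul_upperCut_le b hx
  rw [← h, sub_self, norm_zero, mul_zero] at this
  exact sub_eq_zero.1 (norm_le_zero_iff.1 this)

lemma IsWayBelow.upperCut_left {x y : A} (hx : x ∈ posUnitBall A) (h : IsWayBelow x y) :
    IsWayBelow (cfcₙ upperCut x) y := by
  refine h.cfcₙ_left (k := fun t ↦ (max t (1 / 2))⁻¹ - 2) (κ := 2) hx ?_ (by norm_num) ?_
  · exact (Continuous.inv₀ (by fun_prop) fun t ↦ (max_half_pos _).ne').sub continuous_const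
  · intro t ht
    unfold upperCut
    rcases le_total t (1 / 2) with h | h
    · rw [max_eq_right h, min_eq_right (by linarith)]; ring
    · rw [max_eq_left h, min_eq_left (by linarith)]
      have : t ≠ 0 := by linarith
      field_simp; ring

/-! ### Compression by a spectral cut-off -/

/-- The compression of `c` by the cut-off `lowerCut x`. -/
noncomputable def compression (c x : A) : A := cfcₙ lowerCut x * c * cfcₙ lowerCut x

lemma compression_mem {c x : A} (hc : c ∈ posUnitBall A) (hx : x ∈ posUnitBall A) :
    compression c x ∈ posUnitBall A := by
  have hf := cfcₙ_mem_posUnitBall hx lowerCut_mem_Icc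
  have hs := isSelfAdjoint_of_mem_posUnitBall hf
  refine ⟨?_, ?_⟩
  · have := star_left_conjugate_nonneg hc.1 (cfcₙ lowerCut x)
    rwa [hs.star_eq] at this
  · unfold compression
    calc _ ≤ ‖cfcₙ lowerCut x‖ * ‖c‖ * ‖cfcₙ lowerCut x‖ := norm_mul₃_le
      _ ≤ 1 * 1 * 1 := by
        gcongr
        exacts [hf.2, hc.2, hf.2]
      _ = 1 := by norm_num

lemma continuousOn_compression (c : A) : ContinuousOn (compression c) (posUnitBall A) := by
  have : ContinuousOn (fun x : A ↦ cfcₙ lowerCut x) (posUnitBall A) :=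
    (continuousOn_cfcₙ A isCompact_Icc lowerCut (hf0 := lowerCut_zero)
      (hf := continuous_lowerCut.continuousOn)).mono fun x hx ↦
        ⟨isSelfAdjoint_of_mem_posUnitBall hx, quasispectrum_subset_Icc hx⟩
  exact (this.mul continuousOn_const).mul this

lemma norm_sub_compression_le {c x : A} (hc : c ∈ posUnitBall A) (hx : x ∈ posUnitBall A) :
    ‖c - compression c x‖ ≤ 4 * ‖c - c * x‖ := by
  have hf := cfcₙ_mem_posUnitBall hx lowerCut_mem_Icc
  have hs := (isSelfAdjoint_of_mem_posUnitBall hf).star_eq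
  have hcs := (isSelfAdjoint_of_mem_posUnitBall hc).star_eq
  have h1 := norm_sub_mul_lowerCut_le c hx
  have h2 : ‖c - cfcₙ lowerCut x * c‖ = ‖c - c * cfcₙ lowerCut x‖ := by
    rw [← norm_star, star_sub, star_mul, hs, hcs]
  have h3 : c - compression c x =
      (c - c * cfcₙ lowerCut x) + (c - cfcₙ lowerCut x * c) * cfcₙ lowerCut x := by
    unfold compression; noncomm_ring
  rw [h3]
  calc _ ≤ ‖c - c * cfcₙ lowerCut x‖ + ‖c - cfcₙ lowerCut x * c‖ * ‖cfcₙ lowerCut x‖ :=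
        (norm_add_le _ _).trans (by gcongr; exact norm_mul_le _ _)
    _ ≤ ‖c - c * cfcₙ lowerCut x‖ + ‖c - cfcₙ lowerCut x * c‖ * 1 := by gcongr; exact hf.2
    _ ≤ _ := by rw [h2]; linarith

lemma IsWayBelow.compression {b c x : A} (hx : x ∈ posUnitBall A) (hbc : IsWayBelow b c)
    (hbx : IsWayBelow b x) : IsWayBelow b (compression c x) := by
  have h := hbx.lowerCut_right hx
  unfold IsWayBelow _root_.compression at *
  rw [← mul_assoc, ← mul_assoc, ← h, ← hbc, ← h]

lemma compression_isWayBelow_upperCut {B : Type*} [NonUnitalCStarAlgebra B] (c x : B) :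
    IsWayBelow (compression c x) (cfcₙ upperCut x) := by
  have : cfcₙ lowerCut x * cfcₙ upperCut x = cfcₙ lowerCut x := by
    rw [← cfcₙ_mul lowerCut upperCut x continuous_lowerCut.continuousOn lowerCut_zero
      continuous_upperCut.continuousOn upperCut_zero]
    simp_rw [lowerCut_mul_upperCut]
  unfold IsWayBelow compression
  rw [mul_assoc _ _ (cfcₙ upperCut x), this]

/-! ### Upper bounds far along the canonical approximate unit -/

open Unitization in
/-- The element `1 - (1 - b) * (1 - d) * (1 - b)`, written without a unit, is a positive
contraction. -/
lemma one_sub_conjugate_mem_posUnitBall {b d : A} (hb : b ∈ posUnitBall A)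
    (hd : d ∈ posUnitBall A) :
    2 • b - b * b + (d - b * d - d * b + b * d * b) ∈ posUnitBall A := by
  set c := 2 • b - b * b + (d - b * d - d * b + b * d * b) with hc
  have unit {x : A} (hx : x ∈ posUnitBall A) : 0 ≤ (x : Unitization ℂ A) ∧
      (x : Unitization ℂ A) ≤ 1 := by
    have h0 : 0 ≤ (x : Unitization ℂ A) := inr_nonneg_iff.2 hx.1
    refine ⟨h0, ?_⟩
    rw [← CStarAlgebra.norm_le_one_iff_of_nonneg _ h0, norm_inr]
    exact hx.2
  obtain ⟨hb0, hb1⟩ := unit hb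
  obtain ⟨hd0, hd1⟩ := unit hd
  have hsb : star (1 - (b : Unitization ℂ A)) = 1 - b :=
    (IsSelfAdjoint.of_nonneg (sub_nonneg.2 hb1)).star_eq
  have h1 : 1 - (c : Unitization ℂ A) = star (1 - (b : Unitization ℂ A)) * (1 - d) * (1 - b) := by
    rw [hsb, hc]
    simp only [inr_add, inr_sub, inr_mul, two_smul]
    noncomm_ring
  have hle : (c : Unitization ℂ A) ≤ 1 := by
    rw [← sub_nonneg, h1]
    exact star_left_conjugate_nonneg (sub_nonneg.2 hd1) _
  have hge : 0 ≤ (c : Unitization ℂ A) := by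
    rw [← sub_le_self_iff (1 : Unitization ℂ A), h1]
    calc star (1 - (b : Unitization ℂ A)) * (1 - d) * (1 - b)
        ≤ star (1 - (b : Unitization ℂ A)) * 1 * (1 - b) :=
          star_left_conjugate_le_conjugate (sub_le_self _ hd0) _
      _ ≤ 1 := by
        rw [mul_one]
        have hn : ‖1 - (b : Unitization ℂ A)‖ ≤ 1 := by
          rw [CStarAlgebra.norm_le_one_iff_of_nonneg _ (sub_nonneg.2 hb1)]
          exact sub_le_self _ hb0
        rw [← CStarAlgebra.norm_le_one_iff_of_nonneg _ (star_mul_self_nonneg _),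
          CStarRing.norm_star_mul_self]
        exact mul_le_one₀ hn (norm_nonneg _) hn
  refine ⟨inr_nonneg_iff.1 hge, ?_⟩
  rw [← norm_inr (𝕜 := ℂ), CStarAlgebra.norm_le_one_iff_of_nonneg _ hge]
  exact hle

/-- Everything way below `b` stays way below some `c` that is nearly a right unit for two
prescribed elements. -/
lemma exists_upper_bound_approx {b : A} (hb : b ∈ posUnitBall A) (x y : A) {ε : ℝ} (hε : 0 < ε) :
    ∃ c ∈ posUnitBall A, (∀ b', IsWayBelow b' b → IsWayBelow b' c) ∧
      ‖x - x * c‖ < ε ∧ ‖y - y * c‖ < ε := by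
  have hU := CStarAlgebra.increasingApproximateUnit A
  have near (z : A) : ∀ᶠ d in CStarAlgebra.approximateUnit A, ‖z - z * d‖ < ε / 2 := by
    have := (hU.tendsto_mul_left z).eventually (Metric.ball_mem_nhds z (half_pos hε))
    filter_upwards [this] with d hd
    rwa [dist_comm, dist_eq_norm] at hd
  obtain ⟨d, hd0, hd1, hdx, hdy⟩ := (hU.eventually_nonneg.and <| hU.eventually_norm.and <|
    (near (x - x * b)).and (near (y - y * b))).exists
  have est (z : A) (hz : ‖(z - z * b) - (z - z * b) * d‖ < ε / 2) :
      ‖z - z * (2 • b - b * b + (d - b * d - d * b + b * d * b))‖ < ε := by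
    set w := (z - z * b) - (z - z * b) * d with hw
    have : z - z * (2 • b - b * b + (d - b * d - d * b + b * d * b)) = w - w * b := by
      rw [hw]; noncomm_ring
    rw [this]
    calc _ ≤ ‖w‖ + ‖w‖ * ‖b‖ := (norm_sub_le _ _).trans (by gcongr; exact norm_mul_le _ _)
      _ ≤ ‖w‖ + ‖w‖ * 1 := by gcongr; exact hb.2
      _ < ε := by linarith
  refine ⟨_, one_sub_conjugate_mem_posUnitBall hb ⟨hd0, hd1⟩, fun b' h ↦ ?_, est x hdx, est y hdy⟩
  unfold IsWayBelow at *
  have h1 : b' * (2 • b - b * b + (d - b * d - d * b + b * d * b)) =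
      2 • (b' * b) - b' * b * b + (b' * d - b' * b * d - b' * d * b + b' * b * d * b) := by
    noncomm_ring
  rw [h1, ← h, ← h]
  noncomm_ring

end

/-! ### An inverse limit of perturbations -/

open Filter Topology in
/-- Let `Φ c` be continuous self-maps of a complete metric space such that every `c` satisfying
`P k` can be followed by some `c'` satisfying `P (k + 1)` with `Φ c c'` as close to `c` as desired.
Then there are a sequence `c` satisfying the `P k` and a sequence `e` close to it with
`e n = Φ (c n) (e (n + 1))`. Here `e n` is the limit of `Φ (c n) (Φ (c (n + 1)) (⋯ (c k)))`, so it
lies in every closed set that contains `c k` and is stable under `Φ (c k)` for all `k ≥ n`. -/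
lemma exists_perturbed_seq {X : Type*} [MetricSpace X] [CompleteSpace X] (Φ : X → X → X)
    (hΦ : ∀ c, Continuous (Φ c)) (P : ℕ → X → Prop) (h0 : ∃ c, P 0 c)
    (hstep : ∀ k c, P k c → ∀ U ∈ 𝓝 c, ∃ c', P (k + 1) c' ∧ Φ c c' ∈ U) :
    ∃ c e : ℕ → X, (∀ n, P n (c n)) ∧ (∀ n, e n = Φ (c n) (e (n + 1))) ∧
      (∀ n, dist (c n) (e n) ≤ 2 / 2 ^ n) ∧
      ∀ (Q : Set X) (n : ℕ), IsClosed Q → (∀ k, n ≤ k → c k ∈ Q) →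
        (∀ k, n ≤ k → ∀ x ∈ Q, Φ (c k) x ∈ Q) → e n ∈ Q := by
  classical
  -- The state at stage `k` is `c k` together with the maps `T n = Φ (c n) ∘ ⋯ ∘ Φ (c (k - 1))`,
  -- whose continuity at `c k` dictates how close `Φ (c k) (c (k + 1))` must be to `c k`.
  let S (k : ℕ) := {s : X × (ℕ → X → X) // P k s.1 ∧ ∀ n, Continuous (s.2 n)}
  have next : ∀ k (s : S k), ∃ c', P (k + 1) c' ∧
      ∀ n ≤ k, dist (s.1.2 n s.1.1) (s.1.2 n (Φ s.1.1 c')) < 1 / 2 ^ k := by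
    intro k s
    have hU : ∀ᶠ x in 𝓝 s.1.1, ∀ n ∈ Set.Iic k, dist (s.1.2 n s.1.1) (s.1.2 n x) < 1 / 2 ^ k := by
      rw [eventually_all_finite (Set.finite_Iic k)]
      intro n _
      have := ((s.2.2 n).tendsto s.1.1).eventually
        (Metric.ball_mem_nhds _ (show (0 : ℝ) < 1 / 2 ^ k by positivity))
      filter_upwards [this] with x hx
      rwa [dist_comm]
    obtain ⟨c', h1, h2⟩ := hstep k s.1.1 s.2.1 _ hU
    exact ⟨c', h1, h2⟩
  choose c' hc' hdist using next
  obtain ⟨c₀, hc₀⟩ := h0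
  let st : ∀ k, S k := fun k ↦ Nat.rec ⟨(c₀, fun _ ↦ id), hc₀, fun _ ↦ continuous_id⟩
    (fun k s ↦ ⟨(c' k s, fun n ↦ if n ≤ k then s.1.2 n ∘ Φ s.1.1 else id), hc' k s, fun n ↦ by
      dsimp only
      split_ifs
      · exact (s.2.2 n).comp (hΦ _)
      · exact continuous_id⟩) k
  let c : ℕ → X := fun k ↦ (st k).1.1
  let T : ℕ → ℕ → X → X := fun k ↦ (st k).1.2
  have hTc : ∀ k n, Continuous (T k n) := fun k n ↦ (st k).2.2 n
  have hT1 : ∀ k n, n ≤ k → T (k + 1) n = T k n ∘ Φ (c k) := fun k n h ↦ if_pos h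
  have hTid : ∀ k, T k k = id := by
    intro k
    cases k with
    | zero => rfl
    | succ k => exact if_neg (by omega)
  have hTΦ : ∀ n k, n < k → T k n = Φ (c n) ∘ T k (n + 1) := by
    intro n k hnk
    induction k, (hnk : n + 1 ≤ k) using Nat.le_induction with
    | base => rw [hT1 n n le_rfl, hTid, hTid]; rfl
    | succ k hk ih => rw [hT1 k n (by omega), hT1 k (n + 1) hk, ih, Function.comp_assoc]
  have hd : ∀ n k, n ≤ k → dist (T k n (c k)) (T (k + 1) n (c (k + 1))) < 1 / 2 ^ k := by
    intro n k h
    rw [hT1 k n h]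
    exact hdist k (st k) n h
  have hd' : ∀ n m, dist (T (n + m) n (c (n + m))) (T (n + (m + 1)) n (c (n + (m + 1)))) ≤
      2 / 2 ^ n / 2 / 2 ^ m := by
    intro n m
    refine (hd n (n + m) (by omega)).le.trans (le_of_eq ?_)
    rw [pow_add]; field_simp
  have hlim : ∀ n, ∃ x, Tendsto (fun m ↦ T (n + m) n (c (n + m))) atTop (𝓝 x) := fun n ↦
    cauchySeq_tendsto_of_complete (cauchySeq_of_le_geometric_two (hd' n))
  choose e he using hlim
  refine ⟨c, e, fun n ↦ (st n).2.1, fun n ↦ ?_, fun n ↦ ?_, fun Q n hQ hcQ hΦQ ↦ ?_⟩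
  · have h1 : Tendsto (fun m ↦ T (n + (m + 1)) n (c (n + (m + 1)))) atTop (𝓝 (e n)) :=
      (he n).comp (tendsto_add_atTop_nat 1)
    have h2 : Tendsto (fun m ↦ Φ (c n) (T (n + 1 + m) (n + 1) (c (n + 1 + m)))) atTop
        (𝓝 (Φ (c n) (e (n + 1)))) := ((hΦ (c n)).tendsto _).comp (he (n + 1))
    refine tendsto_nhds_unique h1 (h2.congr fun m ↦ ?_)
    rw [show n + (m + 1) = n + 1 + m by omega, hTΦ n (n + 1 + m) (by omega)]
    rfl
  · have := dist_le_of_le_geometric_two_of_tendsto₀ (hd' n) (he n)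
    simpa [hTid] using this
  · have hTQ : ∀ k, n ≤ k → Set.MapsTo (T k n) Q Q := by
      intro k hk
      induction k, hk using Nat.le_induction with
      | base => rw [hTid]; exact Set.mapsTo_id Q
      | succ k hk ih => rw [hT1 k n hk]; exact ih.comp (hΦQ k hk)
    exact hQ.mem_of_tendsto (he n) (.of_forall fun m ↦ hTQ _ (by omega) (hcQ _ (by omega)))

section

variable {A : Type u} [NonUnitalCStarAlgebra A] [PartialOrder A] [StarOrderedRing A]

/-! ### Extending countable directed sets -/

open Filter Topology in
/-- A `≪`-increasing sequence of positive contractions is dominated by a `≪`-increasing sequence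
that moreover is an approximate right unit for a prescribed element. -/
lemma exists_dominating_seq {b : ℕ → A} (hb : ∀ n, b n ∈ posUnitBall A)
    (hbi : ∀ n, IsWayBelow (b n) (b (n + 1))) (a : A) :
    ∃ v : ℕ → A, (∀ n, v n ∈ posUnitBall A) ∧ (∀ n, IsWayBelow (v n) (v (n + 1))) ∧
      (∀ n, IsWayBelow (b n) (v n)) ∧ Tendsto (fun n ↦ ‖a - a * v n‖) atTop (𝓝 0) := by
  have : CompleteSpace (posUnitBall A) := isClosed_posUnitBall.completeSpace_coe
  let Φ : posUnitBall A → posUnitBall A → posUnitBall A := fun c x ↦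
    ⟨compression c.1 x.1, compression_mem c.2 x.2⟩
  have hΦ : ∀ c, Continuous (Φ c) := fun c ↦
    (continuousOn_iff_continuous_domRestrict.1 (continuousOn_compression c.1)).subtype_mk _
  let P : ℕ → posUnitBall A → Prop := fun k c ↦
    IsWayBelow (b k) c.1 ∧ ‖a - a * c.1‖ < 1 / ((k : ℝ) + 1)
  obtain ⟨c, e, hP, he, hce, hQ⟩ := exists_perturbed_seq Φ hΦ P
    (by
      obtain ⟨c, hc, h1, h2, -⟩ :=
        exists_upper_bound_approx (hb 1) a a (show (0 : ℝ) < 1 / ((0 : ℕ) + 1) by positivity)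
      exact ⟨⟨c, hc⟩, h1 _ (hbi 0), h2⟩)
    (by
      intro k c _ U hU
      obtain ⟨δ, hδ, hδU⟩ := Metric.mem_nhds_iff.1 hU
      -- A bound on `b (k + 2)` rather than `b (k + 1)` turns `b (k + 1) ≪ b (k + 2)` into
      -- `b (k + 1) ≪ c'`.
      obtain ⟨c', hc', h1, h2, h3⟩ := exists_upper_bound_approx (hb (k + 2)) a c.1
        (show (0 : ℝ) < min (1 / (((k + 1 : ℕ) : ℝ) + 1)) (δ / 4) by positivity)
      refine ⟨⟨c', hc'⟩, ⟨h1 _ (hbi (k + 1)), h2.trans_le (min_le_left _ _)⟩, hδU ?_⟩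
      rw [Metric.mem_ball, dist_comm, Subtype.dist_eq, dist_eq_norm]
      have h4 := h3.trans_le (min_le_right _ _)
      have h5 := norm_sub_compression_le c.2 hc'
      change ‖c.1 - compression c.1 c'‖ < δ
      linarith)
  have hbc : ∀ n k, n ≤ k → IsWayBelow (b n) (c k).1 := by
    intro n k hnk
    rcases hnk.eq_or_lt with rfl | hnk
    · exact (hP n).1
    · exact (isWayBelow_of_lt hbi hnk).trans (hP k).1
  have hbe : ∀ n, IsWayBelow (b n) (e n).1 := fun n ↦
    hQ {x | IsWayBelow (b n) x.1} n
      (isClosed_eq continuous_const (continuous_const.mul continuous_subtype_val))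
      (fun k hk ↦ hbc n k hk) (fun k hk x hx ↦ (hbc n k hk).compression x.2 hx)
  refine ⟨fun n ↦ cfcₙ upperCut (e n).1, fun n ↦ cfcₙ_mem_posUnitBall (e n).2 upperCut_mem_Icc,
    fun n ↦ ?_, fun n ↦ (hbe n).upperCut_right (e n).2, ?_⟩
  · refine IsWayBelow.upperCut_left (e n).2 ?_
    rw [he n]
    exact compression_isWayBelow_upperCut _ _
  · have bound : ∀ n, ‖a - a * cfcₙ upperCut (e n).1‖ ≤
        2 * (1 / ((n : ℝ) + 1) + ‖a‖ * (2 * (1 / 2) ^ n)) := by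
      intro n
      refine (norm_sub_mul_upperCut_le a (e n).2).trans ?_
      have h1 : a - a * (e n).1 = (a - a * (c n).1) + a * ((c n).1 - (e n).1) := by noncomm_ring
      have h2 : ‖(c n).1 - (e n).1‖ ≤ 2 * (1 / 2) ^ n := by
        have := hce n
        rw [Subtype.dist_eq, dist_eq_norm] at this
        simpa [div_eq_mul_inv] using this
      gcongr
      rw [h1]
      refine (norm_add_le _ _).trans (add_le_add (hP n).2.le ((norm_mul_le _ _).trans ?_))
      gcongr
    refine squeeze_zero (fun n ↦ norm_nonneg _) bound ?_
    have h1 := tendsto_one_div_add_atTop_nhds_zero_nat (𝕜 := ℝ)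
    have h2 : Tendsto (fun n : ℕ ↦ ((1 : ℝ) / 2) ^ n) atTop (𝓝 0) :=
      tendsto_pow_atTop_nhds_zero_of_lt_one (by norm_num) (by norm_num)
    simpa using (h1.add ((h2.const_mul 2).const_mul ‖a‖)).const_mul 2

/-- A set of positive contractions that is upwards directed for `≪`; it may be empty. -/
structure IsWayBelowDirected (U : Set A) : Prop where
  subset : U ⊆ posUnitBall A
  directed : ∀ x ∈ U, ∀ y ∈ U, ∃ z ∈ U, IsWayBelow x z ∧ IsWayBelow y z

lemma IsWayBelowDirected.exists_cofinal_seq {B : Type*} [NonUnitalCStarAlgebra B] [PartialOrder B]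
    {U : Set B} (hU : IsWayBelowDirected U)
    (hc : U.Countable) : ∃ b : ℕ → B, (∀ n, b n ∈ posUnitBall B) ∧
      (∀ n, IsWayBelow (b n) (b (n + 1))) ∧ ∀ x ∈ U, ∃ n, IsWayBelow x (b n) := by
  rcases U.eq_empty_or_nonempty with rfl | ⟨x₀, hx₀⟩
  · exact ⟨fun _ ↦ 0, fun _ ↦ ⟨le_rfl, by simp⟩, fun _ ↦ by simp [IsWayBelow], by simp⟩
  · have := hc.toEncodable
    have : Inhabited U := ⟨⟨x₀, hx₀⟩⟩
    have hd : Directed IsWayBelow (fun x : U ↦ x.1) := fun x y ↦ by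
      obtain ⟨z, hz, h⟩ := hU.directed x x.2 y y.2
      exact ⟨⟨z, hz⟩, h⟩
    exact ⟨fun n ↦ (hd.sequence _ n).1, fun n ↦ hU.subset (hd.sequence _ n).2,
      hd.sequence_mono_nat, fun x hx ↦ ⟨_, hd.rel_sequence ⟨x, hx⟩⟩⟩

/-- A countable `≪`-directed set extends to one that contains approximate right units for a
prescribed element. -/
lemma IsWayBelowDirected.exists_extension {U : Set A} (hU : IsWayBelowDirected U)
    (hc : U.Countable) (a : A) : ∃ V : Set A, IsWayBelowDirected V ∧ V.Countable ∧ U ⊆ V ∧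
      ∀ ε > 0, ∃ v ∈ V, ‖a - a * v‖ < ε := by
  obtain ⟨b, hb, hbi, hbU⟩ := hU.exists_cofinal_seq hc
  obtain ⟨v, hv, hvi, hbv, hva⟩ := exists_dominating_seq hb hbi a
  have hev : ∀ x ∈ U ∪ Set.range v, ∃ n, ∀ k > n, IsWayBelow x (v k) := by
    rintro x (hx | ⟨n, rfl⟩)
    · obtain ⟨n, hn⟩ := hbU x hx
      exact ⟨n, fun k hk ↦ (hn.trans (hbv n)).trans (isWayBelow_of_lt hvi hk)⟩
    · exact ⟨n, fun k hk ↦ isWayBelow_of_lt hvi hk⟩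
  refine ⟨U ∪ Set.range v, ⟨Set.union_subset hU.subset (Set.range_subset_iff.2 hv), ?_⟩,
    hc.union (Set.countable_range v), Set.subset_union_left, fun ε hε ↦ ?_⟩
  · intro x hx y hy
    obtain ⟨m, hm⟩ := hev x hx
    obtain ⟨n, hn⟩ := hev y hy
    exact ⟨v (max m n + 1), .inr ⟨_, rfl⟩, hm _ (by omega), hn _ (by omega)⟩
  · obtain ⟨n, hn⟩ := (hva.eventually_lt_const hε).exists
    exact ⟨v n, .inr ⟨n, rfl⟩, hn⟩

/-! ### Transfinite recursion -/

lemma IsWayBelowDirected.iUnion {B : Type*} [NonUnitalCStarAlgebra B] [PartialOrder B]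
    {ι : Type*} {V : ι → Set B}
    (hV : ∀ i, IsWayBelowDirected (V i)) (hchain : ∀ i j, V i ⊆ V j ∨ V j ⊆ V i) :
    IsWayBelowDirected (⋃ i, V i) := by
  refine ⟨Set.iUnion_subset fun i ↦ (hV i).subset, fun x hx y hy ↦ ?_⟩
  obtain ⟨i, hi⟩ := Set.mem_iUnion.1 hx
  obtain ⟨j, hj⟩ := Set.mem_iUnion.1 hy
  rcases hchain i j with h | h
  · obtain ⟨z, hz, h⟩ := (hV j).directed x (h hi) y hj
    exact ⟨z, Set.mem_iUnion.2 ⟨j, hz⟩, h⟩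
  · obtain ⟨z, hz, h⟩ := (hV i).directed x hi y (h hj)
    exact ⟨z, Set.mem_iUnion.2 ⟨i, hz⟩, h⟩

lemma exists_wellOrder_countable_initial {ι : Type*} (h : #ι ≤ ℵ_ 1) :
    ∃ r : ι → ι → Prop, IsWellOrder ι r ∧ ∀ i, {j | r j i}.Countable := by
  obtain ⟨r, hr, hord⟩ := Cardinal.exists_ord_eq ι
  refine ⟨r, hr, fun i ↦ ?_⟩
  rw [← Cardinal.le_aleph0_iff_set_countable, ← Cardinal.lt_aleph_one_iff]
  refine lt_of_lt_of_le ?_ h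
  have := Ordinal.typein_lt_type r i
  rw [← hord, Cardinal.lt_ord] at this
  exact this

/-- For every family of at most `ℵ₁` elements there is a `≪`-directed set containing approximate
right units for each of its members. -/
lemma exists_isWayBelowDirected_of_card_le {ι : Type v} (hι : #ι ≤ ℵ_ 1) (u : ι → A) :
    ∃ U : Set A, IsWayBelowDirected U ∧ ∀ i, ∀ ε > 0, ∃ v ∈ U, ‖u i - u i * v‖ < ε := by
  classical
  obtain ⟨r, hr, hcount⟩ := exists_wellOrder_countable_initial hι
  have ext : ∀ (U : Set A) (a : A), ∃ V : Set A, IsWayBelowDirected U → U.Countable →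
      IsWayBelowDirected V ∧ V.Countable ∧ U ⊆ V ∧ ∀ ε > 0, ∃ v ∈ V, ‖a - a * v‖ < ε := by
    intro U a
    by_cases h : IsWayBelowDirected U ∧ U.Countable
    · obtain ⟨V, hV⟩ := h.1.exists_extension h.2 a
      exact ⟨V, fun _ _ ↦ hV⟩
    · exact ⟨∅, fun h1 h2 ↦ (h ⟨h1, h2⟩).elim⟩
  choose E hE using ext
  -- The stage `V i` extends the union of the earlier ones so as to approximate `u i`.
  let V : ι → Set A := hr.wf.fix fun i ih ↦ E (⋃ j : {j // r j i}, ih j.1 j.2) (u i)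
  have hV : ∀ i, V i = E (⋃ j : {j // r j i}, V j.1) (u i) := fun i ↦ hr.wf.fix_eq _ i
  have main : ∀ i, (IsWayBelowDirected (V i) ∧ (V i).Countable) ∧ (∀ j, r j i → V j ⊆ V i) ∧
      ∀ ε > 0, ∃ v ∈ V i, ‖u i - u i * v‖ < ε := by
    intro i
    induction i using hr.wf.induction with
    | _ i ih =>
      have h1 : IsWayBelowDirected (⋃ j : {j // r j i}, V j.1) := by
        refine .iUnion (fun j ↦ (ih j.1 j.2).1.1) fun j k ↦ ?_
        rcases trichotomous_of r j.1 k.1 with h | h | h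
        · exact .inl ((ih k.1 k.2).2.1 _ h)
        · exact .inl (by rw [h])
        · exact .inr ((ih j.1 j.2).2.1 _ h)
      have h2 : (⋃ j : {j // r j i}, V j.1).Countable := by
        have : Countable {j // r j i} := (hcount i).to_subtype
        exact Set.countable_iUnion fun j ↦ (ih j.1 j.2).1.2
      have h3 := hE _ (u i) h1 h2
      rw [← hV i] at h3
      exact ⟨⟨h3.1, h3.2.1⟩,
        fun j hj ↦ (Set.subset_iUnion (fun j : {j // r j i} ↦ V j.1) ⟨j, hj⟩).trans h3.2.2.1,
        h3.2.2.2⟩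
  refine ⟨⋃ i, V i, .iUnion (fun i ↦ (main i).1.1) fun i j ↦ ?_, fun i ε hε ↦ ?_⟩
  · rcases trichotomous_of r i j with h | h | h
    · exact .inl ((main j).2.1 _ h)
    · exact .inl (by rw [h])
    · exact .inr ((main i).2.1 _ h)
  · obtain ⟨v, hv, h⟩ := (main i).2.2 ε hε
    exact ⟨v, Set.mem_iUnion.2 ⟨i, hv⟩, h⟩

lemma norm_sub_mul_le_of_isWayBelow {B : Type*} [NonUnitalCStarAlgebra B] [PartialOrder B]
    {v w : B} (x : B) (hw : w ∈ posUnitBall B)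
    (hvw : IsWayBelow v w) : ‖x - x * w‖ ≤ 2 * ‖x - x * v‖ := by
  have : x - x * w = (x - x * v) - (x - x * v) * w := by
    unfold IsWayBelow at hvw
    rw [sub_mul, mul_assoc, ← hvw]; abel
  rw [this]
  calc _ ≤ ‖x - x * v‖ + ‖x - x * v‖ * ‖w‖ :=
        (norm_sub_le _ _).trans (by gcongr; exact norm_mul_le _ _)
    _ ≤ ‖x - x * v‖ + ‖x - x * v‖ * 1 := by gcongr; exact hw.2
    _ = _ := by ring

end

theorem theorem1p3 {A : Type u} [NonUnitalCStarAlgebra A] [PartialOrder A]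
    [StarOrderedRing A] (hA : IsCardinalUnital (ℵ_ 1 : Cardinal.{v}) A) :
    IsWayBelowUnital A := by
  obtain ⟨Λ, r, u, hcard, hu⟩ := hA
  obtain ⟨U, hU, hUu⟩ := exists_isWayBelowDirected_of_card_le hcard u
  -- `U` itself, ordered by `≪`, indexes the approximate unit.
  refine ⟨U, fun x y ↦ IsWayBelow x.1 y.1, fun x ↦ x.1, ⟨⟨?_, ?_, ?_⟩, fun x ↦ (hU.subset x.2).1,
    fun x ↦ (hU.subset x.2).2, fun a ε hε ↦ ?_⟩, fun x y h ↦ h⟩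
  · obtain ⟨i⟩ := hu.isDirectedSet.nonempty
    obtain ⟨v, hv, -⟩ := hUu i 1 one_pos
    exact ⟨⟨v, hv⟩⟩
  · exact fun x y z ↦ IsWayBelow.trans
  · intro x y
    obtain ⟨z, hz, h⟩ := hU.directed x x.2 y y.2
    exact ⟨⟨z, hz⟩, h⟩
  · -- `a - a * w = (a - a * u i) * (1 - w) + a * (u i - u i * w)`, and both terms are small.
    obtain ⟨i₀, hi₀⟩ := hu.tendsto a (ε / 4) (by positivity)
    obtain ⟨i, hi, -⟩ := hu.isDirectedSet.directed i₀ i₀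
    obtain ⟨v, hv, hvi⟩ := hUu i (ε / (4 * (‖a‖ + 1))) (by positivity)
    refine ⟨⟨v, hv⟩, fun w hw ↦ ?_⟩
    have hwU := hU.subset w.2
    have h1 := hi₀ i hi
    have h2 := norm_sub_mul_le_of_isWayBelow (u i) hwU hw
    have h3 : a - a * w.1 = (a - a * u i) - (a - a * u i) * w.1 + a * (u i - u i * w.1) := by
      noncomm_ring
    have h4 : ‖a‖ * ‖u i - u i * w.1‖ ≤ ε / 2 := by
      have h5 : ‖u i - u i * w.1‖ ≤ 2 * (ε / (4 * (‖a‖ + 1))) := by linarith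
      calc _ ≤ (‖a‖ + 1) * (2 * (ε / (4 * (‖a‖ + 1)))) := by gcongr; linarith
        _ = ε / 2 := by field_simp; ring
    rw [h3]
    calc _ ≤ ‖a - a * u i‖ + ‖a - a * u i‖ * ‖w.1‖ + ‖a‖ * ‖u i - u i * w.1‖ :=
          (norm_add_le _ _).trans (add_le_add ((norm_sub_le _ _).trans
            (by gcongr; exact norm_mul_le _ _)) (norm_mul_le _ _))
      _ ≤ ‖a - a * u i‖ + ‖a - a * u i‖ * 1 + ε / 2 := by gcongr; exact hwU.2
      _ < ε := by linarith
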